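/- For complex $a_1,\dots,a_p$ and complex $b_1,\dots,b_q$, none of the $b_j$ a non-positive integer, with $p\le q$, let $${}_pF_q(a_1,\dots,a_p;b_1,\dots,b_q;z)=\sum_{n=0}^{\infty}\frac{(a_1)_n\cdots(a_p)_n}{(b_1)_n\cdots(b_q)_n}\,\frac{z^n}{n!},\qquad (x)_n=x(x+1)\cdots(x+n-1),$$ and let ${}_p\tilde F_q(a_1,\dots,a_p;b_1,\dots,b_q;z)={}_pF_q(a_1,\dots,a_p;b_1,\dots,b_q;z)/\bigl(\Gamma(b_1)\cdots\Gamma(b_q)\bigr)$ be the regularized function. Then for every $z\in\mathbb{C}$ (with $z^0=1$) $$\begin{aligned}{}_2F_3\left(\tfrac12,\tfrac12;1,1,\tfrac32;z\right)&=\sum_{L=0}^{\infty}\frac{\pi^{2}\,i^{4L}\,2^{-8L-6}\left((-1)^{L}+1\right)^{2}(2L+1)\,\Gamma(2L+2)^{2}}{\Gamma\left(\frac L2+1\right)^{4}\,\Gamma\left(L+\frac32\right)^{2}\,\Gamma\left(\frac12(2L+3)\right)^{2}}\,z^{L}\;{}_1F_2\left(\tfrac L2+\tfrac12;\tfrac L2+1,L+\tfrac32;\tfrac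 z4\right)^{2}\\&=\sum_{L=0}^{\infty}\frac{\pi^{2}\,i^{4L}\,2^{-8L-6}\left((-1)^{L}+1\right)^{2}(2L+1)\,\Gamma(2L+2)^{2}}{\Gamma\left(\frac L2+1\right)^{2}\,\Gamma\left(\frac12(2L+3)\right)^{2}}\,z^{L}\;{}_1\tilde F_2\left(\tfrac L2+\tfrac12;L+\tfrac32,\tfrac L2+1;\tfrac z4\right)^{2},\end{aligned}$$ where both series over $L$ converge absolutely, and their terms with odd $L$ vanish. -/

import Mathlib

/-- The generalized hypergeometric function `pFq(a; b; z) = ∑ₙ (∏ (aᵢ)ₙ / ∏ (bⱼ)ₙ) zⁿ / n!`,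
with `(x)ₙ = x (x + 1) ⋯ (x + n - 1)` the rising factorial, `a` the multiset of the `p` upper
parameters and `b` the multiset of the `q` lower parameters (none of which should be a
non-positive integer). The regularized function is Mathlib's `Complex.regularizedHGFun a b z`. -/
noncomputable def genHypergeometric (a b : Multiset ℂ) (z : ℂ) : ℂ :=
  ∑' n : ℕ, (a.map fun x => (ascPochhammer ℂ n).eval x).prod /
    (b.map fun x => (ascPochhammer ℂ n).eval x).prod * (z ^ n / (n.factorial : ℂ))

open scoped Nat
open Finset.HasAntidiagonal (antidiagonal)

/-! The left side is `∫₀¹ I₀(√z x)² dx`, and the series is Parseval's identity for the even function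
`I₀(√z x)` in the Legendre polynomials `P_{2l}`, with `L = 2l`; odd `L` drop out through `(-1)^L +
1`. No integral is needed: on monomials Parseval is the finite telescoping identity
`sum_legendreMoment_mul`, and bilinearity with absolute convergence extends it to power series
(`hasSum_sq_tsum_mul_legendreMoment`). The `l`-th Legendre coefficient is a multiple of the `₁F₂`
(`tsum_besselWeight_mul_legendreMoment`), and the duplication formula brings its constant to the
stated form (`pi_mul_Gamma_div_eq`). -/

/-- The moment `∫₀¹ x ^ (2 m) P_{2 l}(x) dx` of the Legendre polynomial of degree `2 l`,
given by its recursion in `l`. -/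
noncomputable def legendreMoment (m : ℕ) : ℕ → ℝ
  | 0 => 1 / (2 * m + 1)
  | l + 1 => legendreMoment m l * (2 * (m - l) / (2 * m + 2 * l + 3))

lemma legendreMoment_eq_zero {m l : ℕ} (h : m < l) : legendreMoment m l = 0 := by
  induction l, h using Nat.le_induction with
  | base => simp [legendreMoment]
  | succ l _ ih => simp [legendreMoment, ih]

lemma legendreMoment_nonneg (m l : ℕ) : 0 ≤ legendreMoment m l := by
  induction l with
  | zero => unfold legendreMoment; positivity
  | succ l ih =>
    rcases lt_or_ge m l with h | h
    · rw [legendreMoment_eq_zero (by omega)]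
    · have : (0 : ℝ) ≤ m - l := sub_nonneg.mpr (by exact_mod_cast h)
      unfold legendreMoment
      positivity

/-- Closed form on the support `m ≥ l`, in the shifted index `n = m - l` that becomes the summation
index of the `₁F₂`. -/
lemma legendreMoment_add_self (n l : ℕ) :
    legendreMoment (n + l) l =
      (n + l)! / (n ! * (2 * (ascPochhammer ℝ (l + 1)).eval ((n : ℝ) + l + 1 / 2))) := by
  induction l generalizing n with
  | zero =>
    simp [legendreMoment]
    field_simp
  | succ l ih =>
    have h : legendreMoment (n + (l + 1)) l = legendreMoment ((n + 1) + l) l := by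
      congr 1; ring
    have hp : 0 < (ascPochhammer ℝ (l + 1)).eval ((n : ℝ) + 1 + l + 1 / 2) :=
      ascPochhammer_pos _ _ (by positivity)
    have hf : ((n + 1)! : ℝ) = (n + 1) * n ! := by push_cast [Nat.factorial_succ]; ring
    have hn : (n ! : ℝ) ≠ 0 := by positivity
    have e : n + 1 + l = n + (l + 1) := by ring
    have e' : (n : ℝ) + (l + 1) + 1 / 2 = n + 1 + l + 1 / 2 := by ring
    rw [legendreMoment, h, ih, ascPochhammer_succ_eval (l + 1), hf, e]
    push_cast
    rw [e']
    field_simp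
    ring

/-- The sum telescopes: the subtracted term is the remainder after `N` terms, and it vanishes once
`N > m`. -/
lemma sum_legendreMoment_mul (m n N : ℕ) :
    (2 * m + 2 * n + 1) *
        ∑ l ∈ Finset.range N, (4 * l + 1) * (legendreMoment m l * legendreMoment n l) =
      1 - (2 * m + 2 * N + 1) * (2 * n + 2 * N + 1) *
        (legendreMoment m N * legendreMoment n N) := by
  induction N with
  | zero => simp [legendreMoment]; field_simp; simp
  | succ N ih =>
    rw [Finset.sum_range_succ, mul_add, ih, legendreMoment, legendreMoment]
    push_cast
    field_simp
    ring

/-- Parseval's identity for the monomials `x ^ (2 m)` and `x ^ (2 n)` on `[0, 1]`. -/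
lemma hasSum_legendreMoment_mul (m n : ℕ) :
    HasSum (fun l : ℕ => (4 * l + 1) * (legendreMoment m l * legendreMoment n l))
      (1 / (2 * m + 2 * n + 1) : ℝ) := by
  have h := sum_legendreMoment_mul m n (m + 1)
  rw [legendreMoment_eq_zero (Nat.lt_succ_self m), zero_mul, mul_zero, sub_zero] at h
  rw [one_div, ← eq_inv_of_mul_eq_one_right h]
  refine hasSum_sum_of_ne_finset_zero fun l hl => ?_
  rw [legendreMoment_eq_zero (by simpa using hl), zero_mul, mul_zero]

/-- Bessel's inequality: one term of Parseval's sum with `n = m` is at most the total, which is at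
most 1. -/
lemma legendreMoment_le_one (m l : ℕ) : legendreMoment m l ≤ 1 := by
  have h := le_hasSum (hasSum_legendreMoment_mul m m) l fun j _ =>
    mul_nonneg (by positivity) (mul_nonneg (legendreMoment_nonneg m j) (legendreMoment_nonneg m j))
  have h1 : (1 / (2 * m + 2 * m + 1) : ℝ) ≤ 1 := by
    rw [div_le_one (by positivity)]
    linarith [m.cast_nonneg (α := ℝ)]
  have h2 : (0 : ℝ) ≤ l * (legendreMoment m l * legendreMoment m l) :=
    mul_nonneg l.cast_nonneg (mul_self_nonneg _)
  nlinarith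

/-! ### Parseval for power series -/

lemma summable_mul_legendreMoment {w : ℕ → ℂ} (hw : Summable fun m => ‖w m‖) (l : ℕ) :
    Summable fun m => ‖w m * (legendreMoment m l : ℂ)‖ := by
  refine hw.of_nonneg_of_le (fun _ => norm_nonneg _) fun m => ?_
  rw [norm_mul, Complex.norm_real, Real.norm_of_nonneg (legendreMoment_nonneg m l)]
  exact mul_le_of_le_one_right (norm_nonneg _) (legendreMoment_le_one m l)

/-- Since the moments are nonnegative, the norms summed over `l` are again given by Parseval,
leaving at most `‖w m * w n‖`. -/
lemma summable_mul_mul_legendreMoment {w : ℕ → ℂ} (hw : Summable fun m => ‖w m‖) :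
    Summable fun p : (ℕ × ℕ) × ℕ => w p.1.1 * w p.1.2 *
      (((4 * p.2 + 1) * (legendreMoment p.1.1 p.2 * legendreMoment p.1.2 p.2) : ℝ) : ℂ) := by
  have h0 (m n l : ℕ) : 0 ≤ (4 * l + 1) * (legendreMoment m l * legendreMoment n l) :=
    mul_nonneg (by positivity) (mul_nonneg (legendreMoment_nonneg m l) (legendreMoment_nonneg n l))
  have hfib (q : ℕ × ℕ) : HasSum (fun l : ℕ => ‖w q.1 * w q.2 *
      (((4 * l + 1) * (legendreMoment q.1 l * legendreMoment q.2 l) : ℝ) : ℂ)‖)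
      (‖w q.1 * w q.2‖ * (1 / (2 * q.1 + 2 * q.2 + 1))) := by
    simp_rw [norm_mul (w q.1 * w q.2), Complex.norm_real, Real.norm_of_nonneg (h0 _ _ _)]
    exact (hasSum_legendreMoment_mul q.1 q.2).mul_left _
  refine Summable.of_norm ((summable_prod_of_nonneg fun _ => norm_nonneg _).mpr
    ⟨fun q => (hfib q).summable, ?_⟩)
  refine (summable_mul_of_summable_norm hw hw).norm.of_nonneg_of_le
    (fun q => tsum_nonneg fun _ => norm_nonneg _) fun q => ?_
  rw [(hfib q).tsum_eq]
  refine mul_le_of_le_one_right (norm_nonneg _) ?_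
  rw [div_le_one (by positivity)]
  linarith [q.1.cast_nonneg (α := ℝ), q.2.cast_nonneg (α := ℝ)]

lemma HasSum.sum_antidiagonal {f : ℕ × ℕ → ℂ} {a : ℂ} (hf : HasSum f a) :
    HasSum (fun N => ∑ q ∈ antidiagonal N, f q) a := by
  have h := (Finset.HasAntidiagonal.sigmaAntidiagonalEquivProd (A := ℕ)).hasSum_iff.mpr hf
  refine (h.sigma fun N => hasSum_fintype _).congr_fun fun N => ?_
  exact (Finset.sum_finset_coe f (antidiagonal N)).symm

/-- Parseval's identity for the even power series `∑ wₘ x ^ (2 m)`, as an identity of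
quadratic forms in the coefficients. -/
theorem hasSum_sq_tsum_mul_legendreMoment {w : ℕ → ℂ} (hw : Summable fun m => ‖w m‖) :
    HasSum (fun l : ℕ => (4 * l + 1 : ℂ) * (∑' m, w m * (legendreMoment m l : ℂ)) ^ 2)
      (∑' N : ℕ, (∑ q ∈ antidiagonal N, w q.1 * w q.2) / (2 * N + 1)) := by
  -- Both sides evaluate one triple sum `S`: summing over `l` first gives the kernel `1 / (2m + 2n +
  -- 1)`, summing over `(m, n)` first gives the squares.
  obtain ⟨S, hF⟩ := summable_mul_mul_legendreMoment hw
  have hpairs : HasSum (fun q : ℕ × ℕ => w q.1 * w q.2 * ((1 / (2 * q.1 + 2 * q.2 + 1) : ℝ) : ℂ))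
      S := hF.prod_fiberwise fun q =>
    (Complex.hasSum_ofReal.mpr (hasSum_legendreMoment_mul q.1 q.2)).mul_left (w q.1 * w q.2)
  have hval : ∑' N : ℕ, (∑ q ∈ antidiagonal N, w q.1 * w q.2) / (2 * N + 1) = S := by
    rw [← hpairs.sum_antidiagonal.tsum_eq]
    refine tsum_congr fun N => ?_
    rw [Finset.sum_div]
    refine Finset.sum_congr rfl fun q hq => ?_
    rw [← Finset.HasAntidiagonal.mem_antidiagonal.mp hq]
    push_cast
    ring
  rw [hval]
  have hswap : HasSum (fun p : ℕ × (ℕ × ℕ) => (4 * p.1 + 1 : ℂ) *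
      (w p.2.1 * (legendreMoment p.2.1 p.1 : ℂ) * (w p.2.2 * (legendreMoment p.2.2 p.1 : ℂ)))) S := by
    rw [← (Equiv.prodComm ℕ (ℕ × ℕ)).hasSum_iff] at hF
    refine hF.congr_fun fun p => ?_
    simp only [Function.comp_apply, Equiv.prodComm_apply, Prod.fst_swap, Prod.snd_swap]
    push_cast
    ring
  refine hswap.prod_fiberwise fun l => ?_
  have hs := summable_mul_legendreMoment hw l
  rw [sq, tsum_mul_tsum_of_summable_norm hs hs]
  exact (summable_mul_of_summable_norm hs hs).hasSum.mul_left _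

/-! ### Pochhammer identities -/

lemma ascPochhammer_eval_mul_eval_add (x : ℂ) (n m : ℕ) :
    (ascPochhammer ℂ n).eval x * (ascPochhammer ℂ m).eval (x + n) =
      (ascPochhammer ℂ (n + m)).eval x := by
  rw [← ascPochhammer_mul]
  simp

lemma ne_neg_natCast_of_re_pos {x : ℂ} (hx : 0 < x.re) (k : ℕ) : x ≠ -(k : ℂ) := by
  rintro rfl
  simp at hx
  linarith [k.cast_nonneg (α := ℝ)]

lemma ascPochhammer_eval_ne_zero {x : ℂ} (hx : 0 < x.re) (n : ℕ) :
    (ascPochhammer ℂ n).eval x ≠ 0 := by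
  rw [Ne, ascPochhammer_eval_eq_zero_iff]
  rintro ⟨k, -, hk⟩
  exact ne_neg_natCast_of_re_pos hx k (by rw [hk, neg_neg])

lemma four_pow_mul_ascPochhammer_half (N : ℕ) :
    4 ^ N * (ascPochhammer ℂ N).eval (1 / 2) = N.centralBinom * N ! := by
  induction N with
  | zero => simp
  | succ N ih =>
    have h : ((N : ℂ) + 1) * (N + 1).centralBinom = 2 * (2 * N + 1) * N.centralBinom := by
      exact_mod_cast N.succ_mul_centralBinom_succ
    rw [ascPochhammer_succ_eval, Nat.factorial_succ]
    push_cast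
    linear_combination (4 * (1 / 2 + N) : ℂ) * ih - (N ! : ℂ) * h

lemma ascPochhammer_three_halves (N : ℕ) :
    (ascPochhammer ℂ N).eval (3 / 2) = (2 * N + 1) * (ascPochhammer ℂ N).eval (1 / 2) := by
  have h1 := ascPochhammer_eval_mul_eval_add (1 / 2) 1 N
  have e : (1 / 2 : ℂ) + (1 : ℕ) = 3 / 2 := by norm_num
  rw [add_comm 1 N, ascPochhammer_succ_eval N, e, ascPochhammer_one, Polynomial.eval_X] at h1
  linear_combination 2 * h1

/-- The coefficients of the even power series `I₀(√z x) = ∑ besselWeight z m * x ^ (2 m)`. -/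
noncomputable def besselWeight (z : ℂ) (m : ℕ) : ℂ := (z / 4) ^ m / (m ! : ℂ) ^ 2

lemma summable_norm_besselWeight (z : ℂ) : Summable fun m => ‖besselWeight z m‖ := by
  refine (Real.summable_pow_div_factorial ‖z / 4‖).of_nonneg_of_le (fun _ => norm_nonneg _)
    fun m => ?_
  rw [besselWeight, norm_div, norm_pow, norm_pow, Complex.norm_natCast]
  have h : (1 : ℝ) ≤ m ! := by exact_mod_cast m.factorial_pos
  gcongr
  exact le_self_pow₀ h two_ne_zero

/-- Coefficients of `I₀²`, by Vandermonde's `∑ (N choose i)² = (2N choose N)`. -/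
lemma sum_antidiagonal_besselWeight (z : ℂ) (N : ℕ) :
    ∑ q ∈ antidiagonal N, besselWeight z q.1 * besselWeight z q.2 =
      (z / 4) ^ N * N.centralBinom / (N ! : ℂ) ^ 2 := by
  have hc : (N.centralBinom : ℂ) =
      ∑ q ∈ antidiagonal N, (N.choose q.1 : ℂ) ^ 2 := by
    rw [Finset.Nat.sum_antidiagonal_eq_sum_range_succ_mk, Nat.centralBinom,
      ← Nat.sum_range_choose_sq]
    push_cast
    rfl
  rw [hc, Finset.mul_sum, Finset.sum_div]
  refine Finset.sum_congr rfl fun q hq => ?_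
  obtain ⟨i, j⟩ := q
  obtain rfl : i + j = N := by simpa using hq
  have hfac := Nat.add_choose_mul_factorial_mul_factorial i j
  rw [← Nat.choose_symm_add] at hfac
  have hi : (i ! : ℂ) ≠ 0 := by exact_mod_cast i.factorial_ne_zero
  have hj : (j ! : ℂ) ≠ 0 := by exact_mod_cast j.factorial_ne_zero
  have hn : ((i + j).choose i : ℂ) ≠ 0 := by
    exact_mod_cast (Nat.choose_pos (Nat.le_add_right i j)).ne'
  rw [← hfac]
  simp only [besselWeight]
  push_cast
  field_simp
  ring

lemma tsum_sum_antidiagonal_besselWeight (z : ℂ) :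
    ∑' N : ℕ, (∑ q ∈ antidiagonal N, besselWeight z q.1 * besselWeight z q.2) /
      (2 * N + 1) = genHypergeometric {1 / 2, 1 / 2} {1, 1, 3 / 2} z := by
  refine tsum_congr fun N => ?_
  have h := four_pow_mul_ascPochhammer_half N
  have h0 : (ascPochhammer ℂ N).eval (1 / 2) ≠ 0 := ascPochhammer_eval_ne_zero (by norm_num) N
  have h1 : (2 * N + 1 : ℂ) ≠ 0 := by exact_mod_cast (2 * N).succ_ne_zero
  have hN : (N ! : ℂ) ≠ 0 := by exact_mod_cast N.factorial_ne_zero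
  rw [sum_antidiagonal_besselWeight]
  simp only [Multiset.insert_eq_cons, Multiset.map_cons, Multiset.map_singleton,
    Multiset.prod_cons, Multiset.prod_singleton, ascPochhammer_eval_one,
    ascPochhammer_three_halves]
  have hb : (N.centralBinom : ℂ) = 4 ^ N * (ascPochhammer ℂ N).eval (1 / 2) / N ! := by
    rw [h]; field_simp
  rw [hb, div_pow]
  field_simp

lemma tsum_besselWeight_mul_legendreMoment (z : ℂ) (l : ℕ) :
    ∑' m, besselWeight z m * (legendreMoment m l : ℂ) =
      z ^ l / (4 ^ l * l ! * (2 * (ascPochhammer ℂ (l + 1)).eval ((l : ℂ) + 1 / 2))) *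
        genHypergeometric {(l : ℂ) + 1 / 2} {(l : ℂ) + 1, 2 * (l : ℂ) + 3 / 2} (z / 4) := by
  have hinj : Function.Injective (· + l) := add_left_injective l
  -- Terms with `m < l` vanish, so the sum runs over `m = n + l`.
  rw [← hinj.tsum_eq, genHypergeometric, ← tsum_mul_left]
  · refine tsum_congr fun n => ?_
    have hcast : (((ascPochhammer ℝ (l + 1)).eval ((n : ℝ) + l + 1 / 2) : ℝ) : ℂ) =
        (ascPochhammer ℂ (l + 1)).eval ((n : ℂ) + l + 1 / 2) := by
      have := Polynomial.eval_map_apply (p := ascPochhammer ℝ (l + 1)) Complex.ofRealHom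
        ((n : ℝ) + l + 1 / 2)
      rw [ascPochhammer_map] at this
      simpa using this.symm
    -- Splitting `(l + 1/2)_{n+l+1}` in two ways trades `(n + l + 1/2)_{l+1}` for `(2l + 3/2)_n`.
    have h1 := ascPochhammer_eval_mul_eval_add ((l : ℂ) + 1 / 2) n (l + 1)
    have h2 := ascPochhammer_eval_mul_eval_add ((l : ℂ) + 1 / 2) (l + 1) n
    have h3 := ascPochhammer_eval_mul_eval_add 1 l n
    rw [ascPochhammer_eval_one, ascPochhammer_eval_one] at h3
    rw [add_comm (l + 1) n, ← h1] at h2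
    have e1 : (l : ℂ) + 1 / 2 + n = n + l + 1 / 2 := by ring
    have e2 : (l : ℂ) + 1 / 2 + (l + 1 : ℕ) = 2 * l + 3 / 2 := by push_cast; ring
    rw [e1, e2] at h2
    rw [add_comm 1 (l : ℂ), add_comm l n] at h3
    have hl : (l ! : ℂ) ≠ 0 := by exact_mod_cast l.factorial_ne_zero
    have hn : (n ! : ℂ) ≠ 0 := by exact_mod_cast n.factorial_ne_zero
    have p1 : (ascPochhammer ℂ (l + 1)).eval ((n : ℂ) + l + 1 / 2) ≠ 0 :=
      ascPochhammer_eval_ne_zero (by simp; positivity) _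
    have p2 : (ascPochhammer ℂ (l + 1)).eval ((l : ℂ) + 1 / 2) ≠ 0 :=
      ascPochhammer_eval_ne_zero (by simp; positivity) _
    have p3 : (ascPochhammer ℂ n).eval (2 * (l : ℂ) + 3 / 2) ≠ 0 :=
      ascPochhammer_eval_ne_zero (by simp; positivity) _
    have p4 : (ascPochhammer ℂ n).eval ((l : ℂ) + 1) ≠ 0 :=
      ascPochhammer_eval_ne_zero (by simp; positivity) _
    simp only [besselWeight, legendreMoment_add_self, Multiset.insert_eq_cons, Multiset.map_cons,
      Multiset.map_singleton, Multiset.prod_cons, Multiset.prod_singleton]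
    push_cast
    rw [hcast, ← h3, pow_add, div_pow z 4 l]
    generalize (ascPochhammer ℂ (l + 1)).eval ((n : ℂ) + l + 1 / 2) = P₁ at *
    generalize (ascPochhammer ℂ (l + 1)).eval ((l : ℂ) + 1 / 2) = P₂ at *
    generalize (ascPochhammer ℂ n).eval (2 * (l : ℂ) + 3 / 2) = P₃ at *
    generalize (ascPochhammer ℂ n).eval ((l : ℂ) + 1) = P₄ at *
    generalize (ascPochhammer ℂ n).eval ((l : ℂ) + 1 / 2) = P₅ at *
    field_simp
    linear_combination (z ^ n * z ^ l * (1 / 4) ^ n) * h2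
  · intro m hm
    by_contra hlt
    refine hm ?_
    have : m < l := by
      by_contra h
      exact hlt ⟨m - l, Nat.sub_add_cancel (not_lt.mp h)⟩
    simp [legendreMoment_eq_zero this]

/-! ### Gamma factors and the two series -/

/-- The regularized hypergeometric function is the hypergeometric function divided by the
Gamma values of its lower parameters. -/
theorem regularizedHGFun_eq_genHypergeometric_div (a b : Multiset ℂ)
    (hb : ∀ x ∈ b, ∀ k : ℕ, x ≠ -(k : ℂ)) (z : ℂ) :
    Complex.regularizedHGFun a b z = genHypergeometric a b z / (b.map Complex.Gamma).prod := by
  have hsum : Complex.regularizedHGFun a b z =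
      ∑' n : ℕ, Complex.regularizedHGFunCoeff a b n * z ^ n :=
    FormalMultilinearSeries.ofScalars_sum_eq _ z
  rw [hsum, genHypergeometric, ← tsum_div_const]
  refine tsum_congr fun n => ?_
  have hmap : (b.map (Complex.Gamma <| · + (n : ℂ))).prod =
      (b.map Complex.Gamma).prod * (b.map fun x => (ascPochhammer ℂ n).eval x).prod := by
    rw [← Multiset.prod_map_mul]
    congr 1
    refine Multiset.map_congr rfl fun x hx => ?_
    rw [← Complex.Gamma_add_nat_div_Gamma_eq x (hb x hx),
      mul_div_cancel₀ _ (Complex.Gamma_ne_zero (hb x hx))]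
  rw [Complex.regularizedHGFunCoeff, hmap]
  simp only [div_eq_mul_inv, mul_inv]
  ring

lemma pi_mul_Gamma_div_eq (l : ℕ) :
    (Real.pi : ℂ) * Complex.Gamma (4 * l + 2) /
        (2 ^ (8 * l + 2) * ((l ! : ℂ) ^ 2 * Complex.Gamma (2 * l + 3 / 2) ^ 2)) =
      1 / (4 ^ l * l ! * (2 * (ascPochhammer ℂ (l + 1)).eval ((l : ℂ) + 1 / 2))) := by
  have hpi : ((√Real.pi : ℝ) : ℂ) ^ 2 = Real.pi := by
    exact_mod_cast Real.sq_sqrt Real.pi_pos.le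
  have hpi0 : ((√Real.pi : ℝ) : ℂ) ≠ 0 := by
    exact_mod_cast (Real.sqrt_pos.mpr Real.pi_pos).ne'
  have hl : (l ! : ℂ) ≠ 0 := by exact_mod_cast l.factorial_ne_zero
  -- Duplication at `2l + 1` and at `l + 1/2`: both involve `Γ(2l + 1)`, which then cancels.
  have d1 := Complex.Gamma_mul_Gamma_add_half (2 * l + 1)
  have d2 := Complex.Gamma_mul_Gamma_add_half (l + 1 / 2)
  have hG : Complex.Gamma (l + 1 / 2) ≠ 0 :=
    Complex.Gamma_ne_zero_of_re_pos (by simp; positivity)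
  have hG' : Complex.Gamma (2 * l + 3 / 2) ≠ 0 :=
    Complex.Gamma_ne_zero_of_re_pos (by simp; positivity)
  have hG2 : Complex.Gamma (2 * l + 1) ≠ 0 :=
    Complex.Gamma_ne_zero_of_re_pos (by simp; positivity)
  have hP := Complex.Gamma_add_nat_div_Gamma_eq (n := l + 1) ((l : ℂ) + 1 / 2)
    (ne_neg_natCast_of_re_pos (by simp; positivity))
  have e1 : (l : ℂ) + 1 / 2 + (l + 1 : ℕ) = 2 * l + 3 / 2 := by push_cast; ring
  have e2 : (2 * l + 1 : ℂ) + 1 / 2 = 2 * l + 3 / 2 := by ring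
  have e3 : 2 * (2 * l + 1 : ℂ) = 4 * l + 2 := by ring
  have e4 : (l + 1 / 2 : ℂ) + 1 / 2 = l + 1 := by ring
  have e5 : 2 * (l + 1 / 2 : ℂ) = 2 * l + 1 := by ring
  have c1 : (2 : ℂ) ^ (1 - (4 * l + 2) : ℂ) = (2 ^ (4 * l + 1))⁻¹ := by
    rw [← Complex.cpow_natCast, ← Complex.cpow_neg]
    congr 1; push_cast; ring
  have c2 : (2 : ℂ) ^ (1 - (2 * l + 1) : ℂ) = (2 ^ (2 * l))⁻¹ := by
    rw [← Complex.cpow_natCast, ← Complex.cpow_neg]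
    congr 1; push_cast; ring
  rw [e2, e3, c1] at d1
  rw [e4, e5, c2, Complex.Gamma_nat_eq_factorial] at d2
  rw [e1] at hP
  have h4 : Complex.Gamma (4 * l + 2) = Complex.Gamma (2 * l + 1) *
      Complex.Gamma (2 * l + 3 / 2) * 2 ^ (4 * l + 1) / (√Real.pi : ℝ) := by
    rw [d1]; field_simp
  have h2 : Complex.Gamma (l + 1 / 2) =
      Complex.Gamma (2 * l + 1) * (√Real.pi : ℝ) / (2 ^ (2 * l) * l !) := by
    rw [eq_div_iff (mul_ne_zero (pow_ne_zero _ two_ne_zero) hl), mul_comm (2 ^ (2 * l) : ℂ), ← mul_assoc, d2]; field_simp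
  have h44 : (4 : ℂ) ^ l = 2 ^ (2 * l) := by rw [pow_mul]; norm_num
  rw [← hP, h4, h2, ← hpi, h44]
  field_simp
  ring

lemma gamma_coeff_two_mul (l : ℕ) (D : ℂ) :
    (Real.pi : ℂ) ^ 2 * Complex.I ^ (4 * (2 * l)) *
        (2 : ℂ) ^ (-8 * ((2 * l : ℕ) : ℤ) - 6) * ((-1 : ℂ) ^ (2 * l) + 1) ^ 2 *
        (2 * ((2 * l : ℕ) : ℂ) + 1) * Complex.Gamma (2 * ((2 * l : ℕ) : ℂ) + 2) ^ 2 / D =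
      (4 * l + 1) * (Real.pi * Complex.Gamma (4 * l + 2) / 2 ^ (8 * l + 2)) ^ 2 / D := by
  have hI : Complex.I ^ (4 * (2 * l)) = 1 := by rw [pow_mul, Complex.I_pow_four, one_pow]
  -- The factor 4 is split off to cancel `((-1)^(2l) + 1)² = 4`.
  have h2 : (2 : ℂ) ^ (-8 * ((2 * l : ℕ) : ℤ) - 6) = (4 * (2 ^ (8 * l + 2)) ^ 2)⁻¹ := by
    have e : (4 * (2 ^ (8 * l + 2)) ^ 2 : ℂ) = 2 ^ (16 * l + 6) := by ring
    rw [e, ← zpow_natCast, ← zpow_neg]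
    congr 1; push_cast; ring
  have e : 2 * ((2 * l : ℕ) : ℂ) = 4 * l := by push_cast; ring
  rw [hI, h2, e, pow_mul (-1 : ℂ)]
  field_simp
  norm_num

theorem hasSum_sq_genHypergeometric (z : ℂ) :
    HasSum
      (fun L : ℕ =>
        ((Real.pi : ℂ) ^ 2 * Complex.I ^ (4 * L) * (2 : ℂ) ^ (-8 * (L : ℤ) - 6) *
            ((-1 : ℂ) ^ L + 1) ^ 2 * (2 * (L : ℂ) + 1) * Complex.Gamma (2 * (L : ℂ) + 2) ^ 2 /
          (Complex.Gamma ((L : ℂ) / 2 + 1) ^ 4 * Complex.Gamma ((L : ℂ) + 3 / 2) ^ 2 *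
            Complex.Gamma ((1 / 2 : ℂ) * (2 * (L : ℂ) + 3)) ^ 2)) *
          z ^ L *
          genHypergeometric {(L : ℂ) / 2 + 1 / 2} {(L : ℂ) / 2 + 1, (L : ℂ) + 3 / 2} (z / 4) ^ 2)
      (genHypergeometric {1 / 2, 1 / 2} {1, 1, 3 / 2} z) := by
  have hinj : Function.Injective (2 * · : ℕ → ℕ) := mul_right_injective₀ two_ne_zero
  rw [← hinj.hasSum_iff]
  · have h := hasSum_sq_tsum_mul_legendreMoment (summable_norm_besselWeight z)
    rw [tsum_sum_antidiagonal_besselWeight] at h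
    convert h using 2 with l
    have e1 : ((2 * l : ℕ) : ℂ) / 2 = l := by push_cast; ring
    have e2 : (1 / 2 : ℂ) * (2 * ((2 * l : ℕ) : ℂ) + 3) = 2 * l + 3 / 2 := by push_cast; ring
    have e3 : ((2 * l : ℕ) : ℂ) + 3 / 2 = 2 * l + 3 / 2 := by push_cast; ring
    rw [Function.comp_apply, gamma_coeff_two_mul, e1, e2, e3, Complex.Gamma_nat_eq_factorial,
      tsum_besselWeight_mul_legendreMoment, div_eq_mul_one_div (z ^ l), ← pi_mul_Gamma_div_eq]
    simp only [div_eq_mul_inv, mul_inv, mul_pow]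
    ring
  · intro L hL
    have hodd : Odd L := Nat.not_even_iff_odd.mp fun ⟨k, hk⟩ => hL ⟨k, by simp only; omega⟩
    simp [hodd.neg_one_pow]

theorem mainTheorem3 (z : ℂ) :
    HasSum
      (fun L : ℕ =>
        ((Real.pi : ℂ) ^ 2 * Complex.I ^ (4 * L) * (2 : ℂ) ^ (-8 * (L : ℤ) - 6) *
            ((-1 : ℂ) ^ L + 1) ^ 2 * (2 * (L : ℂ) + 1) * Complex.Gamma (2 * (L : ℂ) + 2) ^ 2 /
          (Complex.Gamma ((L : ℂ) / 2 + 1) ^ 4 * Complex.Gamma ((L : ℂ) + 3 / 2) ^ 2 *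
            Complex.Gamma ((1 / 2 : ℂ) * (2 * (L : ℂ) + 3)) ^ 2)) *
          z ^ L *
          genHypergeometric {(L : ℂ) / 2 + 1 / 2} {(L : ℂ) / 2 + 1, (L : ℂ) + 3 / 2} (z / 4) ^ 2)
      (genHypergeometric {1 / 2, 1 / 2} {1, 1, 3 / 2} z) ∧
    HasSum
      (fun L : ℕ =>
        ((Real.pi : ℂ) ^ 2 * Complex.I ^ (4 * L) * (2 : ℂ) ^ (-8 * (L : ℤ) - 6) *
            ((-1 : ℂ) ^ L + 1) ^ 2 * (2 * (L : ℂ) + 1) * Complex.Gamma (2 * (L : ℂ) + 2) ^ 2 /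
          (Complex.Gamma ((L : ℂ) / 2 + 1) ^ 2 *
            Complex.Gamma ((1 / 2 : ℂ) * (2 * (L : ℂ) + 3)) ^ 2)) *
          z ^ L *
          Complex.regularizedHGFun {(L : ℂ) / 2 + 1 / 2} {(L : ℂ) + 3 / 2, (L : ℂ) / 2 + 1} (z / 4) ^ 2)
      (genHypergeometric {1 / 2, 1 / 2} {1, 1, 3 / 2} z) := by
  refine ⟨hasSum_sq_genHypergeometric z, ?_⟩
  -- The series agree termwise: regularizing the squared `₁F₂` supplies the missing `Γ(L/2 + 1)² Γ(L
  -- + 3/2)²` in the denominator.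
  convert hasSum_sq_genHypergeometric z using 2 with L
  have e : (1 / 2 : ℂ) * (2 * (L : ℂ) + 3) = L + 3 / 2 := by ring
  have h1 : 0 < ((L : ℂ) / 2 + 1).re := by
    have : (L : ℂ) / 2 + 1 = ((L / 2 + 1 : ℝ) : ℂ) := by push_cast; rfl
    rw [this, Complex.ofReal_re]
    positivity
  have h2 : 0 < ((L : ℂ) + 3 / 2).re := by simp; positivity
  have hG1 := Complex.Gamma_ne_zero_of_re_pos h1
  have hG2 := Complex.Gamma_ne_zero_of_re_pos h2
  rw [regularizedHGFun_eq_genHypergeometric_div _ _ (by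
    simpa using ⟨ne_neg_natCast_of_re_pos h2, ne_neg_natCast_of_re_pos h1⟩),
    Multiset.pair_comm, e]
  simp only [Multiset.insert_eq_cons, Multiset.map_cons, Multiset.map_singleton,
    Multiset.prod_cons, Multiset.prod_singleton]
  field_simp
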